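/- For a finite partially ordered set $L$ let $f_{i-1}(L)$ be the number of $i$-element chains of $L$ (so $f_{-1}(L)=1$), let $N$ be the largest cardinality of a chain of $L$, and put $$h_L(x)=\sum_{i=0}^{N} f_{i-1}(L)\,x^i(1-x)^{N-i}.$$ For $n\ge 1$ let $\Pi^B_n$ be the set of all partitions $\pi$ of $\{-n,-n+1,\dots,n\}$ such that (i) $-B\in\pi$ for every block $B\in\pi$, and (ii) if $\{i,-i\}\subseteq B$ for some $i\in\{1,\dots,n\}$ and some block $B\in\pi$, then $0\in B$. It is partially ordered by $\pi\le\pi'$ if every block of $\pi$ is contained in a block of $\pi'$. A polynomial with real coefficients is real-rooted if it is zero or all of its complex roots are real. A real-rooted polynomial $f$ with roots $\alpha_1\ge\alpha_2\ge\cdots$ interlaces a real-rooted polynomial $g$ with roots $\beta_1\ge\beta_2\ge\cdots$ (roots counted with multiplicity) if $\cdots\le\alpha_2\le\beta_2\le\alpha_1\le\beta_1$, where this alternating chain contains all roots of $f$ and of $g$ (so $g$ has as many roots as $f$ or one more); by convention the zero polynomial interlaces, and is interlaced by, every real-rooted polynomial. Then, for every $n\ge 1$, the polynomial $h_{\Pi^B_n}(x)$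 is real-rooted and it interlaces $h_{\Pi^B_{n+1}}(x)$. -/

import Mathlib

/-- The type `B` partition lattice `Π^B_n`: the set partitions `π` of `{-n, …, n}` such that
(i) `-B` is a block of `π` for every block `B` of `π`;
(ii) a block containing `{i, -i}` for some `i ∈ {1, …, n}` also contains `0`.
The order is inherited from `Finpartition`: `π ≤ π'` iff every block of `π` is contained in a
block of `π'`. -/
abbrev PiB (n : ℕ) : Type :=
  {π : Finpartition (Finset.Icc (-(n : ℤ)) (n : ℤ)) //
    (∀ B ∈ π.parts, B.image (fun i => -i) ∈ π.parts) ∧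
    (∀ B ∈ π.parts, ∀ i ∈ Finset.Icc (1 : ℤ) (n : ℤ), i ∈ B → -i ∈ B → (0 : ℤ) ∈ B)}

section OrderComplex

variable (P : Type*) [PartialOrder P] [Fintype P]

open scoped Classical in
/-- The order complex of a finite poset `P`: the set of all chains of `P`, including the empty
chain, which is the face of dimension `-1`. -/
noncomputable def orderComplex : Finset (Finset P) :=
  Finset.univ.filter fun C : Finset P => IsChain (· ≤ ·) (C : Set P)

/-- The number of chains of `P` with exactly `i` elements, that is, the number of
`(i - 1)`-dimensional faces of the order complex. -/
noncomputable def numChains (i : ℕ) : ℕ :=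
  ((orderComplex P).filter fun C => C.card = i).card

/-- The largest cardinality of a chain of `P`. -/
noncomputable def maxChainCard : ℕ :=
  (orderComplex P).sup Finset.card

open Polynomial in
/-- The `h`-polynomial of the order complex of `P`,
`h_P(x) = ∑_{i=0}^{N} f_{i-1} x^i (1 - x)^{N-i}`, where `f_{i-1}` is the number of `i`-element
chains of `P` and `N` is the largest cardinality of a chain of `P`. -/
noncomputable def hPoly : Polynomial ℝ :=
  ∑ i ∈ Finset.range (maxChainCard P + 1),
    C (numChains P i : ℝ) * X ^ i * (1 - X) ^ (maxChainCard P - i)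

end OrderComplex

/-- A real polynomial is real-rooted if it is zero or all its complex roots are real. -/
def IsRealRooted (f : Polynomial ℝ) : Prop :=
  f = 0 ∨ ∀ z : ℂ, Polynomial.aeval z f = 0 → z.im = 0

/-- The real roots of `f` with multiplicity, in weakly decreasing order. -/
noncomputable def rootList (f : Polynomial ℝ) : List ℝ :=
  f.roots.sort (fun a b => a ≥ b)

/-- `f` interlaces `g`: both are real-rooted and either one of them is zero, or the roots
`α₁ ≥ α₂ ≥ ⋯` of `f` and `β₁ ≥ β₂ ≥ ⋯` of `g`, listed with multiplicity, satisfy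
`⋯ ≤ α₂ ≤ β₂ ≤ α₁ ≤ β₁`, an alternating chain which uses all the roots, so that `g` has as many
roots as `f` or one more. -/
def Interlaces (f g : Polynomial ℝ) : Prop :=
  IsRealRooted f ∧ IsRealRooted g ∧
    (f = 0 ∨ g = 0 ∨
      (((rootList g).length = (rootList f).length ∨
          (rootList g).length = (rootList f).length + 1) ∧
        (∀ (i : ℕ) (hf : i < (rootList f).length) (hg : i < (rootList g).length),
          (rootList f)[i] ≤ (rootList g)[i]) ∧
        (∀ (i : ℕ) (hf : i < (rootList f).length) (hg : i + 1 < (rootList g).length),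
          (rootList g)[i + 1] ≤ (rootList f)[i])))

open Polynomial

theorem eval_wronskian (f g : ℝ[X]) (x : ℝ) : (wronskian f g).eval x =
    f.eval x * (derivative g).eval x - (derivative f).eval x * g.eval x := by
  simp [wronskian]

theorem wronskian_sum_left {ι : Type*} (s : Finset ι) (f : ι → ℝ[X]) (g : ℝ[X]) :
    wronskian (∑ i ∈ s, f i) g = ∑ i ∈ s, wronskian (f i) g := by
  simp [wronskian, Finset.sum_mul, Finset.sum_sub_distrib]

theorem wronskian_sum_right {ι : Type*} (s : Finset ι) (f : ι → ℝ[X]) (g : ℝ[X]) :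
    wronskian g (∑ i ∈ s, f i) = ∑ i ∈ s, wronskian g (f i) := by
  simp [wronskian, Finset.mul_sum, Finset.sum_sub_distrib]

/-- The Wronskian conditions expressing that `f`, `g`, `X * f` is an interlacing sequence. -/
def WronskianLE (f g : ℝ[X]) : Prop :=
  ∀ x : ℝ, 0 ≤ (wronskian f g).eval x ∧ 0 ≤ (wronskian g (X * f)).eval x

theorem WronskianLE.sum_left {ι : Type*} {s : Finset ι} {f : ι → ℝ[X]} {g : ℝ[X]}
    (h : ∀ i ∈ s, WronskianLE (f i) g) : WronskianLE (∑ i ∈ s, f i) g := by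
  intro x
  rw [Finset.mul_sum, wronskian_sum_left, wronskian_sum_right, eval_finsetSum,
    eval_finsetSum]
  exact ⟨Finset.sum_nonneg fun i hi => (h i hi x).1, Finset.sum_nonneg fun i hi => (h i hi x).2⟩

theorem WronskianLE.sum_right {ι : Type*} {s : Finset ι} {f : ι → ℝ[X]} {g : ℝ[X]}
    (h : ∀ i ∈ s, WronskianLE g (f i)) : WronskianLE g (∑ i ∈ s, f i) := by
  intro x
  rw [wronskian_sum_left, wronskian_sum_right, eval_finsetSum, eval_finsetSum]
  exact ⟨Finset.sum_nonneg fun i hi => (h i hi x).1, Finset.sum_nonneg fun i hi => (h i hi x).2⟩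

theorem WronskianLE.C_mul {f g : ℝ[X]} (h : WronskianLE f g) {a b : ℝ} (ha : 0 ≤ a) (hb : 0 ≤ b) :
    WronskianLE (C a * f) (C b * g) := by
  intro x
  have h1 : wronskian (C a * f) (C b * g) = C (a * b) * wronskian f g := by
    simp [wronskian]; ring
  have h2 : wronskian (C b * g) (X * (C a * f)) = C (a * b) * wronskian g (X * f) := by
    simp [wronskian]; ring
  rw [h1, h2, eval_mul, eval_mul, eval_C]
  exact ⟨mul_nonneg (mul_nonneg ha hb) (h x).1, mul_nonneg (mul_nonneg ha hb) (h x).2⟩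

theorem sq_le_eval_wronskian {A B D : ℝ[X]} (hAB : WronskianLE A B) (hBD : WronskianLE B D)
    (x : ℝ) : (B.eval x) ^ 2 ≤ (wronskian (X * A + B + D) (X * A + X * B + D)).eval x := by
  have h1 := (hAB x).1
  have h2 := (hAB x).2
  have h3 := (hBD x).1
  have h4 := (hBD x).2
  have h5 := mul_nonneg (sq_nonneg x) h1
  simp only [wronskian, derivative_add, derivative_mul, derivative_X, eval_add, eval_mul,
    eval_sub, eval_X, eval_one] at *
  linarith

theorem WronskianLE.shift {A B D : ℝ[X]} (hAB : WronskianLE A B) (hBD : WronskianLE B D) :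
    WronskianLE (X * A + B + D) (X * A + X * B + D) := by
  intro x
  refine ⟨(sq_nonneg _).trans (sq_le_eval_wronskian hAB hBD x), ?_⟩
  have h1 := mul_nonneg (sq_nonneg x) (hAB x).1
  have h2 := mul_nonneg (sq_nonneg x) (hAB x).2
  have h3 := mul_nonneg (sq_nonneg x) (hBD x).1
  have h4 := (hBD x).2
  have h5 := sq_nonneg (x * A.eval x + D.eval x)
  simp only [wronskian, derivative_add, derivative_mul, derivative_X, eval_add, eval_mul,
    eval_sub, eval_X, eval_one] at *
  linarith

/-- A refinement of the `h`-polynomials of the type `B` partition lattices by an Eulerian type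
recurrence. -/
noncomputable def hRefined : ℕ → ℕ → ℝ[X]
  | 0, _ => 1
  | n + 1, j => ∑ i ∈ Finset.range (n + 1),
      (if i < j then X else 1) * (C (2 * i + 1 : ℝ) * hRefined n i)

theorem hRefined_zero_succ (n : ℕ) : hRefined (n + 1) 0 =
    ∑ i ∈ Finset.range (n + 1), C (2 * i + 1 : ℝ) * hRefined n i := by
  simp [hRefined]

theorem hRefined_self_succ (n : ℕ) : hRefined (n + 1) (n + 1) = X * hRefined (n + 1) 0 := by
  rw [hRefined_zero_succ, hRefined, Finset.mul_sum]
  refine Finset.sum_congr rfl fun i hi => ?_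
  rw [if_pos (Finset.mem_range.1 hi)]

theorem hRefined_eq_add {n j : ℕ} (hj : j ≤ n) : hRefined (n + 1) j =
    hRefined (n + 1) (j + 1) + (1 - X) * (C (2 * j + 1 : ℝ) * hRefined n j) := by
  have hm : j ∈ Finset.range (n + 1) := Finset.mem_range.2 (by omega)
  rw [hRefined, hRefined, ← Finset.add_sum_erase _ _ hm, ← Finset.add_sum_erase _ _ hm]
  have : ∀ i ∈ (Finset.range (n + 1)).erase j,
      (if i < j + 1 then (X : ℝ[X]) else 1) * (C (2 * i + 1 : ℝ) * hRefined n i) =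
      (if i < j then (X : ℝ[X]) else 1) * (C (2 * i + 1 : ℝ) * hRefined n i) := by
    intro i hi
    have hne := Finset.ne_of_mem_erase hi
    have : i < j + 1 ↔ i < j := by omega
    simp only [this]
  rw [Finset.sum_congr rfl this]
  simp
  ring

/-- A partial sum of the terms occurring in the recurrence for `hRefined`. -/
noncomputable def hPartial (n a b : ℕ) : ℝ[X] :=
  ∑ i ∈ Finset.Ico a b, C (2 * i + 1 : ℝ) * hRefined n i

theorem hRefined_eq_hPartial {n k : ℕ} (hk : k ≤ n + 1) :
    hRefined (n + 1) k = X * hPartial n 0 k + hPartial n k (n + 1) := by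
  rw [hRefined, Finset.range_eq_Ico, ← Finset.sum_Ico_consecutive _ (Nat.zero_le k) hk, hPartial,
    hPartial, Finset.mul_sum]
  congr 1
  · refine Finset.sum_congr rfl fun i hi => ?_
    rw [if_pos (Finset.mem_Ico.1 hi).2]
  · refine Finset.sum_congr rfl fun i hi => ?_
    rw [if_neg (Finset.mem_Ico.1 hi).1.not_gt, one_mul]

/-- Splitting the recurrence at two indices `j ≤ k`. -/
theorem hRefined_split {n j k : ℕ} (hjk : j ≤ k) (hk : k ≤ n + 1) :
    hRefined (n + 1) j = X * hPartial n 0 j + hPartial n j k + hPartial n k (n + 1) ∧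
    hRefined (n + 1) k = X * hPartial n 0 j + X * hPartial n j k + hPartial n k (n + 1) := by
  have h1 : hPartial n 0 k = hPartial n 0 j + hPartial n j k :=
    (Finset.sum_Ico_consecutive _ (Nat.zero_le j) hjk).symm
  have h2 : hPartial n j (n + 1) = hPartial n j k + hPartial n k (n + 1) :=
    (Finset.sum_Ico_consecutive _ hjk hk).symm
  rw [hRefined_eq_hPartial (hjk.trans hk), hRefined_eq_hPartial hk, h1, h2]
  constructor <;> ring

theorem wronskianLE_hPartial {n : ℕ}
    (h : ∀ i j, i < j → j ≤ n → WronskianLE (hRefined n i) (hRefined n j)) {a b c : ℕ} (d : ℕ)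
    (hbc : b ≤ c) (hd : d ≤ n + 1) :
    WronskianLE (hPartial n a b) (hPartial n c d) := by
  refine WronskianLE.sum_left fun i hi => WronskianLE.sum_right fun j hj => ?_
  simp only [Finset.mem_Ico] at hi hj
  exact (h i j (by omega) (by omega)).C_mul (by positivity) (by positivity)

theorem wronskianLE_hRefined (n : ℕ) :
    ∀ i j, i < j → j ≤ n → WronskianLE (hRefined n i) (hRefined n j) := by
  induction n with
  | zero => intro i j h1 h2; omega
  | succ n ih =>
    intro j k hjk hk
    obtain ⟨h1, h2⟩ := hRefined_split hjk.le hk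
    rw [h1, h2]
    exact (wronskianLE_hPartial ih _ le_rfl (by omega)).shift
      (wronskianLE_hPartial ih _ le_rfl (by omega))

theorem eval_one_hRefined_pos (n j : ℕ) : 0 < (hRefined n j).eval 1 := by
  induction n generalizing j with
  | zero => simp [hRefined]
  | succ n ih =>
    rw [hRefined, eval_finsetSum]
    refine Finset.sum_pos (fun i _ => ?_) ⟨0, by simp⟩
    have := ih i
    split_ifs <;> simp <;> positivity

theorem exists_eval_hRefined_ne_zero (n : ℕ) (x : ℝ) : ∃ i ≤ n, (hRefined n i).eval x ≠ 0 := by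
  induction n with
  | zero => exact ⟨0, le_rfl, by simp [hRefined]⟩
  | succ n ih =>
    by_contra! h
    obtain ⟨i, hi, hne⟩ := ih
    have h1 := congrArg (eval x) (hRefined_eq_add hi)
    rw [h i (by omega), eval_add, h (i + 1) (by omega)] at h1
    simp only [eval_mul, eval_sub, eval_one, eval_X, eval_C, zero_add] at h1
    have hw : (2 * i + 1 : ℝ) ≠ 0 := by positivity
    have hx : 1 - x = 0 := by
      by_contra hx
      exact mul_ne_zero hx (mul_ne_zero hw hne) h1.symm
    have hx1 : x = 1 := by linarith
    have := eval_one_hRefined_pos (n + 1) 0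
    rw [← hx1, h 0 (by omega)] at this
    exact lt_irrefl _ this

theorem eval_wronskian_hRefined_pos (n : ℕ) (x : ℝ) :
    0 < (wronskian (hRefined (n + 1) 0) (hRefined (n + 2) 0)).eval x := by
  have key : ∀ k ≤ n + 1, (eval x (hPartial n 0 k)) ^ 2 ≤
      (wronskian (hRefined (n + 1) 0) (hRefined (n + 1) k)).eval x := by
    intro k hk
    obtain ⟨h1, h2⟩ := hRefined_split (Nat.zero_le k) hk
    rw [h1, h2]
    exact sq_le_eval_wronskian
      (wronskianLE_hPartial (wronskianLE_hRefined n) k le_rfl (by omega))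
      (wronskianLE_hPartial (wronskianLE_hRefined n) (n + 1) le_rfl (by omega)) x
  rw [hRefined_zero_succ (n + 1), wronskian_sum_right, eval_finsetSum]
  have hC : ∀ i : ℕ, (wronskian (hRefined (n + 1) 0) (C (2 * i + 1 : ℝ) * hRefined (n + 1) i)) =
      C (2 * i + 1 : ℝ) * wronskian (hRefined (n + 1) 0) (hRefined (n + 1) i) := by
    intro i; simp [wronskian]; ring
  have hnn : ∀ i ∈ Finset.range (n + 2), 0 ≤ eval x
      (wronskian (hRefined (n + 1) 0) (C (2 * i + 1 : ℝ) * hRefined (n + 1) i)) := by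
    intro i hi
    rw [hC, eval_mul, eval_C]
    exact mul_nonneg (by positivity)
      ((sq_nonneg _).trans (key i (by have := Finset.mem_range.1 hi; omega)))
  refine lt_of_le_of_ne (Finset.sum_nonneg hnn) fun h0 => ?_
  have hz := (Finset.sum_eq_zero_iff_of_nonneg hnn).1 h0.symm
  have hs : ∀ k ≤ n + 1, eval x (hPartial n 0 k) = 0 := by
    intro k hk
    have h1 := hz k (Finset.mem_range.2 (by omega))
    rw [hC, eval_mul, eval_C] at h1
    have h2 := (mul_eq_zero.1 h1).resolve_left (by positivity)
    have h3 := key k hk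
    rw [h2] at h3
    exact pow_eq_zero_iff (two_ne_zero) |>.1 (le_antisymm h3 (sq_nonneg _))
  obtain ⟨i, hi, hne⟩ := exists_eval_hRefined_ne_zero n x
  have h1 := hs (i + 1) (by omega)
  rw [hPartial, Finset.sum_Ico_succ_top (Nat.zero_le i), ← hPartial, eval_add, hs i (by omega),
    zero_add, eval_mul, eval_C] at h1
  exact hne ((mul_eq_zero.1 h1).resolve_left (by positivity))

theorem degree_hRefined (n : ℕ) : (∀ j ≤ n, (hRefined (n + 1) j).natDegree ≤ n) ∧
    0 < (hRefined (n + 1) 0).coeff n := by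
  induction n with
  | zero => simp [hRefined]
  | succ n ih =>
    have hX : (hRefined (n + 1) (n + 1)).natDegree ≤ n + 1 := by
      rw [hRefined_self_succ]
      refine natDegree_mul_le.trans ?_
      have := ih.1 0 (Nat.zero_le _)
      rw [natDegree_X]; omega
    refine ⟨fun j hj => ?_, ?_⟩
    · rw [hRefined]
      refine natDegree_sum_le_of_forall_le _ _ fun i hi => ?_
      have hi' := Finset.mem_range.1 hi
      have hC := natDegree_C_mul_le (2 * i + 1 : ℝ) (hRefined (n + 1) i)
      split_ifs with h
      · refine natDegree_mul_le.trans ?_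
        have := ih.1 i (by omega)
        rw [natDegree_X]; omega
      · rw [one_mul]
        refine hC.trans ?_
        rcases Nat.lt_or_ge i (n + 1) with h | h
        · have := ih.1 i (by omega); omega
        · obtain rfl : i = n + 1 := by omega
          exact hX
    · rw [hRefined_zero_succ, Finset.sum_range_succ, coeff_add, finsetSum_coeff,
        Finset.sum_eq_zero, zero_add, coeff_C_mul, hRefined_self_succ, coeff_X_mul]
      · exact mul_pos (by positivity) ih.2
      · intro i hi
        rw [coeff_C_mul, coeff_eq_zero_of_natDegree_lt, mul_zero]
        have := Finset.mem_range.1 hi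
        have := ih.1 i (by omega)
        omega

theorem natDegree_hRefined (n : ℕ) : (hRefined (n + 1) 0).natDegree = n :=
  natDegree_eq_of_le_of_coeff_ne_zero ((degree_hRefined n).1 0 (Nat.zero_le _))
    (degree_hRefined n).2.ne'

/-- Under a nowhere vanishing Wronskian and `deg f < deg g`, the polynomial `g` has a root beyond
every root of `f`. -/
theorem exists_root_gt {f g : ℝ[X]} (hW : ∀ x, 0 < (wronskian f g).eval x)
    (hdeg : f.degree < g.degree) {a : ℝ} (ha : f.eval a = 0) : ∃ b, a < b ∧ g.eval b = 0 := by
  by_contra! h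
  have hga : g.eval a ≠ 0 := by
    intro h0
    have := hW a
    rw [eval_wronskian, ha, h0] at this
    simp at this
  have hg : ∀ x ∈ Set.Ici a, g.eval x ≠ 0 := by
    intro x hx
    rcases (Set.mem_Ici.1 hx).eq_or_lt with rfl | hx
    exacts [hga, h x hx]
  have hanti : StrictAntiOn (fun x => f.eval x / g.eval x) (Set.Ici a) := by
    refine strictAntiOn_of_deriv_neg (convex_Ici a)
      (f.continuous.continuousOn.div g.continuous.continuousOn hg) fun x hx => ?_
    have hgx := hg x (interior_subset hx)
    rw [((f.hasDerivAt x).fun_div (g.hasDerivAt x) hgx).deriv]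
    refine div_neg_of_neg_of_pos ?_ (by positivity)
    have := hW x
    rw [eval_wronskian] at this
    linarith
  have hlim := Polynomial.div_tendsto_atTop_zero_of_degree_lt f g hdeg
  have h1 : f.eval (a + 1) / g.eval (a + 1) < 0 := by
    have := hanti (Set.self_mem_Ici) (Set.mem_Ici.2 (by linarith : a ≤ a + 1)) (by linarith)
    simpa [ha] using this
  refine absurd (le_of_tendsto hlim ?_) (not_le.2 h1)
  filter_upwards [Filter.eventually_ge_atTop (a + 1)] with x hx
  exact hanti.antitoneOn (Set.mem_Ici.2 (by linarith)) (Set.mem_Ici.2 (by linarith)) hx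

theorem exists_root_lt {f g : ℝ[X]} (hW : ∀ x, 0 < (wronskian f g).eval x)
    (hdeg : f.degree < g.degree) {a : ℝ} (ha : f.eval a = 0) : ∃ b, b < a ∧ g.eval b = 0 := by
  have hd : ∀ p : ℝ[X], (p.comp (-X)).degree = p.degree := by
    intro p
    by_cases hp : p = 0
    · simp [hp]
    · have h0 : p.comp (-X) ≠ 0 := fun h => hp <| by
        have := congrArg (fun q => q.comp (-X)) h
        simpa [comp_assoc] using this
      rw [degree_eq_natDegree hp, degree_eq_natDegree h0, natDegree_comp]
      simp
  obtain ⟨b, hb, hgb⟩ := exists_root_gt (f := f.comp (-X)) (g := -g.comp (-X)) (a := -a)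
    (fun x => by
      have := hW (-x)
      rw [eval_wronskian] at this ⊢
      simp [derivative_comp] at this ⊢
      linarith)
    (by rw [degree_neg, hd, hd]; exact hdeg) (by simpa using ha)
  exact ⟨-b, by linarith, by simpa using hgb⟩

theorem exists_root_between {f g : ℝ[X]} (hW : ∀ x, 0 < (wronskian f g).eval x)
    {a c : ℝ} (hac : a < c) (ha : f.eval a = 0) (hc : f.eval c = 0) :
    ∃ b, a < b ∧ b < c ∧ g.eval b = 0 := by
  by_contra! h
  have hroot : ∀ a, f.eval a = 0 → g.eval a ≠ 0 := by
    intro a ha h0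
    have := hW a
    rw [eval_wronskian, ha, h0] at this
    simp at this
  have hg : ∀ x ∈ Set.Icc a c, g.eval x ≠ 0 := by
    intro x hx
    rcases hx.1.eq_or_lt with rfl | h1
    · exact hroot _ ha
    rcases hx.2.eq_or_lt with rfl | h2
    exacts [hroot _ hc, h x h1 h2]
  obtain ⟨x, hx, hx0⟩ := exists_deriv_eq_zero (f := fun x => f.eval x / g.eval x) hac
    (f.continuous.continuousOn.div g.continuous.continuousOn hg) (by simp [ha, hc])
  have hgx := hg x (Set.Ioo_subset_Icc_self hx)
  rw [((f.hasDerivAt x).fun_div (g.hasDerivAt x) hgx).deriv, div_eq_zero_iff] at hx0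
  have h1 := hx0.resolve_right (by positivity)
  have := hW x
  rw [eval_wronskian] at this
  linarith

theorem exists_interlacing_roots {m : ℕ} {f g : ℝ[X]} (hW : ∀ x, 0 < (wronskian f g).eval x)
    (hg : g.natDegree = m + 1) (hdeg : f.degree < g.degree) {α : Fin m → ℝ} (hα : StrictAnti α)
    (hroot : ∀ i, f.eval (α i) = 0) :
    ∃ β : Fin (m + 1) → ℝ, (∀ i : Fin m, β i.succ < α i ∧ α i < β i.castSucc) ∧
      ∀ i, g.eval (β i) = 0 := by
  have key : ∀ i : Fin (m + 1), ∃ b, (∀ j : Fin m, j.succ = i → b < α j) ∧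
      (∀ j : Fin m, j.castSucc = i → α j < b) ∧ g.eval b = 0 := by
    intro i
    rcases Nat.eq_zero_or_pos m with rfl | hm
    · obtain ⟨b, hb⟩ := exists_root_of_degree_eq_one
        (by rw [degree_eq_natDegree (by rintro rfl; simp at hg), hg]; rfl : g.degree = 1)
      exact ⟨b, fun j => j.elim0, fun j => j.elim0, hb⟩
    · rcases Fin.eq_zero_or_eq_succ i with rfl | ⟨k, rfl⟩
      · obtain ⟨b, hb, hgb⟩ := exists_root_gt hW hdeg (hroot ⟨0, hm⟩)
        refine ⟨b, fun j hj => absurd hj (Fin.succ_ne_zero j), fun j hj => ?_, hgb⟩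
        have : j = ⟨0, hm⟩ := by
          ext; simpa using congrArg Fin.val hj
        rwa [this]
      · by_cases hk : (k : ℕ) + 1 < m
        · obtain ⟨b, hb1, hb2, hgb⟩ := exists_root_between hW
            (hα (show k < ⟨k + 1, hk⟩ from Fin.lt_def.2 (by simp))) (hroot _) (hroot _)
          refine ⟨b, fun j hj => ?_, fun j hj => ?_, hgb⟩
          · rwa [Fin.succ_injective _ hj]
          · have : j = ⟨k + 1, hk⟩ := by
              ext; simpa using congrArg Fin.val hj
            rwa [this]
        · obtain ⟨b, hb, hgb⟩ := exists_root_lt hW hdeg (hroot k)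
          refine ⟨b, fun j hj => ?_, fun j hj => ?_, hgb⟩
          · rwa [Fin.succ_injective _ hj]
          · have h1 := congrArg Fin.val hj
            simp at h1
            omega
  choose β h1 h2 h3 using key
  exact ⟨β, fun i => ⟨h1 _ i rfl, h2 _ i rfl⟩, h3⟩

theorem strictAnti_of_interlacing {m : ℕ} {α : Fin m → ℝ} {β : Fin (m + 1) → ℝ}
    (h : ∀ i : Fin m, β i.succ < α i ∧ α i < β i.castSucc) : StrictAnti β :=
  Fin.strictAnti_iff_succ_lt.2 fun i => (h i).1.trans (h i).2

theorem roots_eq_of_strictAnti {m : ℕ} {f : ℝ[X]} (hf : f ≠ 0) (hdeg : f.natDegree = m)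
    {α : Fin m → ℝ} (hα : StrictAnti α) (hroot : ∀ i, f.eval (α i) = 0) :
    f.roots = (List.ofFn α : Multiset ℝ) := by
  symm
  refine Multiset.eq_of_le_of_card_le ?_ ?_
  · refine (Multiset.le_iff_subset ?_).2 ?_
    · exact Multiset.coe_nodup.2 (List.nodup_ofFn.2 hα.injective)
    · intro x hx
      obtain ⟨i, rfl⟩ := List.mem_ofFn.1 (Multiset.mem_coe.1 hx)
      exact (mem_roots hf).2 (hroot i)
  · simpa [hdeg] using f.card_roots'

theorem rootList_eq_ofFn {m : ℕ} {f : ℝ[X]} (hf : f ≠ 0) (hdeg : f.natDegree = m)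
    {α : Fin m → ℝ} (hα : StrictAnti α) (hroot : ∀ i, f.eval (α i) = 0) :
    rootList f = List.ofFn α := by
  rw [rootList, roots_eq_of_strictAnti hf hdeg hα hroot]
  have : (List.ofFn α).Pairwise (fun a b => a ≥ b) := by
    rw [List.pairwise_ofFn]
    exact fun i j hij => (hα hij).le
  rw [Multiset.coe_sort]
  exact List.mergeSort_of_pairwise (by simpa using this)

theorem isRealRooted_of_strictAnti {m : ℕ} {f : ℝ[X]} (hf : f ≠ 0) (hdeg : f.natDegree = m)
    {α : Fin m → ℝ} (hα : StrictAnti α) (hroot : ∀ i, f.eval (α i) = 0) : IsRealRooted f := by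
  refine Or.inr fun z hz => ?_
  have hs : f.Splits := by
    rw [splits_iff_card_roots, roots_eq_of_strictAnti hf hdeg hα hroot]
    simp [hdeg]
  rw [hs.eq_prod_roots, map_mul, map_multiset_prod, aeval_C, mul_eq_zero] at hz
  have hz := hz.resolve_left (by simpa using hf)
  rw [Multiset.map_map, Multiset.prod_eq_zero_iff, Multiset.mem_map] at hz
  obtain ⟨a, -, ha⟩ := hz
  have : z = (a : ℂ) := by simpa [sub_eq_zero] using ha
  rw [this, Complex.ofReal_im]

theorem interlaces_of_roots {m : ℕ} {f g : ℝ[X]} (hf : f ≠ 0) (hg : g ≠ 0)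
    (hfd : f.natDegree = m) (hgd : g.natDegree = m + 1) {α : Fin m → ℝ} {β : Fin (m + 1) → ℝ}
    (hα : StrictAnti α) (h : ∀ i : Fin m, β i.succ < α i ∧ α i < β i.castSucc)
    (hfr : ∀ i, f.eval (α i) = 0) (hgr : ∀ i, g.eval (β i) = 0) : Interlaces f g := by
  have hβ := strictAnti_of_interlacing h
  refine ⟨isRealRooted_of_strictAnti hf hfd hα hfr, isRealRooted_of_strictAnti hg hgd hβ hgr,
    Or.inr (Or.inr ?_)⟩
  rw [rootList_eq_ofFn hf hfd hα hfr, rootList_eq_ofFn hg hgd hβ hgr]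
  refine ⟨Or.inr (by simp), fun i h1 h2 => ?_, fun i h1 h2 => ?_⟩
  · rw [List.getElem_ofFn, List.getElem_ofFn]
    exact (h ⟨i, by simpa using h1⟩).2.le
  · rw [List.getElem_ofFn, List.getElem_ofFn]
    exact (h ⟨i, by simpa using h1⟩).1.le

theorem hRefined_ne_zero (n : ℕ) : hRefined (n + 1) 0 ≠ 0 := fun h => by
  have := (degree_hRefined n).2
  rw [h] at this
  simp at this

theorem exists_roots_hRefined (n : ℕ) : ∃ α : Fin n → ℝ, StrictAnti α ∧
    (∀ i, (hRefined (n + 1) 0).eval (α i) = 0) ∧ ∃ β : Fin (n + 1) → ℝ,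
    (∀ i : Fin n, β i.succ < α i ∧ α i < β i.castSucc) ∧
      ∀ i, (hRefined (n + 2) 0).eval (β i) = 0 := by
  have step : ∀ (n : ℕ) (α : Fin n → ℝ), StrictAnti α →
      (∀ i, (hRefined (n + 1) 0).eval (α i) = 0) → ∃ β : Fin (n + 1) → ℝ,
      (∀ i : Fin n, β i.succ < α i ∧ α i < β i.castSucc) ∧
        ∀ i, (hRefined (n + 2) 0).eval (β i) = 0 := fun n α hα hroot =>
    exists_interlacing_roots (eval_wronskian_hRefined_pos n) (natDegree_hRefined (n + 1))
      (degree_lt_degree (by rw [natDegree_hRefined, natDegree_hRefined]; omega)) hα hroot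
  induction n with
  | zero => exact ⟨Fin.elim0, fun i => i.elim0, fun i => i.elim0,
      step 0 _ (fun i => i.elim0) fun i => i.elim0⟩
  | succ n ih =>
    obtain ⟨α, hα, hroot, β, hβ, hβr⟩ := ih
    have := strictAnti_of_interlacing hβ
    exact ⟨β, this, hβr, step _ β this hβr⟩

theorem interlaces_hRefined (n : ℕ) : Interlaces (hRefined (n + 1) 0) (hRefined (n + 2) 0) := by
  obtain ⟨α, hα, hroot, β, hβ, hβr⟩ := exists_roots_hRefined n
  exact interlaces_of_roots (hRefined_ne_zero n) (hRefined_ne_zero (n + 1)) (natDegree_hRefined n)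
    (natDegree_hRefined (n + 1)) hα hβ hroot hβr

/-- The operator describing how the number of nonzero block pairs of a type `B` partition changes
when a pair of opposite elements is added to the ground set. -/
def blockShift (φ : ℕ → ℝ) (k : ℕ) : ℝ := φ (k + 1) + (2 * k + 1) * φ k

theorem eval_hRefined_eq_blockShift {t : ℝ} (ht : 1 - t ≠ 0) (n : ℕ) :
    (∀ j, 1 ≤ j → j ≤ n → (hRefined n j).eval t = t * (1 - t) ^ n *
      (blockShift^[n - j] fun k => (hRefined k 0).eval t / (1 - t) ^ k) j) ∧
    (hRefined n 0).eval t - (1 - t) ^ (n + 1) = t * (1 - t) ^ n *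
      (blockShift^[n] fun k => (hRefined k 0).eval t / (1 - t) ^ k) 0 := by
  set u : ℕ → ℝ := fun k => (hRefined k 0).eval t / (1 - t) ^ k with hu
  induction n with
  | zero => exact ⟨fun j h1 h2 => by omega, by simp [hu, hRefined]⟩
  | succ n ih =>
    have h1 : ∀ d j, 1 ≤ j → j + d = n + 1 → (hRefined (n + 1) j).eval t =
        t * (1 - t) ^ (n + 1) * (blockShift^[d] u) j := by
      intro d
      induction d with
      | zero =>
        rintro j hj rfl
        simp only [Function.iterate_zero, id]
        rw [hRefined_self_succ, eval_mul, eval_X, hu]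
        field_simp
      | succ d ihd =>
        intro j hj hd
        rw [hRefined_eq_add (by omega), eval_add, ihd (j + 1) (by omega) (by omega),
          Function.iterate_succ_apply', blockShift]
        simp only [eval_mul, eval_sub, eval_one, eval_X, eval_C]
        rw [ih.1 j hj (by omega), show n - j = d by omega]
        ring
    refine ⟨fun j hj hjn => h1 _ _ hj (by omega), ?_⟩
    rw [hRefined_eq_add (Nat.zero_le n), eval_add, h1 n (0 + 1) le_rfl (by omega),
      Function.iterate_succ_apply', blockShift]
    simp only [eval_mul, eval_sub, eval_one, eval_X, eval_C]
    have := ih.2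
    rw [sub_eq_iff_eq_add] at this
    rw [this]
    push_cast
    ring

theorem eval_hRefined_recurrence {t : ℝ} (ht : 1 - t ≠ 0) (n : ℕ) :
    (1 + t / (1 - t)) * ((hRefined n 0).eval t / (1 - t) ^ n) = 1 + t / (1 - t) *
      (blockShift^[n] fun k => (hRefined k 0).eval t / (1 - t) ^ k) 0 := by
  have := (eval_hRefined_eq_blockShift ht n).2
  generalize (blockShift^[n] fun k => (hRefined k 0).eval t / (1 - t) ^ k) 0 = z at *
  rw [sub_eq_iff_eq_add] at this
  rw [this]
  field_simp
  ring

section ChainSum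

variable {P Q : Type*} [PartialOrder P] [Fintype P] [PartialOrder Q] [Fintype Q]

/-- The chain polynomial of a finite poset, evaluated at `y`. -/
noncomputable def chainSum (P : Type*) [PartialOrder P] [Fintype P] (y : ℝ) : ℝ :=
  ∑ C ∈ orderComplex P, y ^ C.card

theorem mem_orderComplex {C : Finset P} :
    C ∈ orderComplex P ↔ IsChain (· ≤ ·) (C : Set P) := by
  simp [orderComplex]

theorem card_le_maxChainCard {C : Finset P} (hC : C ∈ orderComplex P) :
    C.card ≤ maxChainCard P :=
  Finset.le_sup (f := Finset.card) hC

open Polynomial in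
theorem eval_hPoly {t : ℝ} (ht : 1 - t ≠ 0) :
    (hPoly P).eval t = (1 - t) ^ maxChainCard P * chainSum P (t / (1 - t)) := by
  have h : ∀ i ∈ Finset.range (maxChainCard P + 1),
      eval t (C (numChains P i : ℝ) * X ^ i * (1 - X) ^ (maxChainCard P - i)) =
      ∑ D ∈ (orderComplex P).filter (fun D => D.card = i),
        (1 - t) ^ maxChainCard P * (t / (1 - t)) ^ D.card := by
    intro i hi
    have hi' : i ≤ maxChainCard P := Nat.lt_succ_iff.1 (Finset.mem_range.1 hi)
    have hc : ∀ D ∈ (orderComplex P).filter (fun D => D.card = i),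
        (1 - t) ^ maxChainCard P * (t / (1 - t)) ^ D.card =
        t ^ i * (1 - t) ^ (maxChainCard P - i) := by
      intro D hD
      rw [(Finset.mem_filter.1 hD).2, div_pow, ← Nat.sub_add_cancel hi', pow_add,
        Nat.add_sub_cancel]
      field_simp
    rw [Finset.sum_congr rfl hc, Finset.sum_const, nsmul_eq_mul, numChains]
    simp
    ring
  rw [hPoly, eval_finsetSum, Finset.sum_congr rfl h, Finset.sum_fiberwise_of_maps_to, chainSum,
    Finset.mul_sum]
  intro D hD
  exact Finset.mem_range.2 (Nat.lt_succ_iff.2 (card_le_maxChainCard hD))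

open scoped Classical in
theorem chainSum_of_orderEmbedding (f : Q ↪o P) (y : ℝ) : chainSum Q y =
    ∑ C ∈ (orderComplex P).filter (fun C => ∀ c ∈ C, c ∈ Set.range f), y ^ C.card := by
  refine Finset.sum_bij (fun C _ => C.map f.toEmbedding) ?_ ?_ ?_ ?_
  · intro C hC
    rw [mem_orderComplex] at hC
    refine Finset.mem_filter.2 ⟨mem_orderComplex.2 ?_, by simp⟩
    rintro a ha b hb hab
    simp only [Finset.coe_map, Set.mem_image] at ha hb
    obtain ⟨a, ha, rfl⟩ := ha
    obtain ⟨b, hb, rfl⟩ := hb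
    have := hC ha hb (fun h => hab (by rw [h]))
    simpa using this
  · intro C _ D _ h
    exact Finset.map_injective _ h
  · intro D hD
    obtain ⟨h1, h2⟩ := Finset.mem_filter.1 hD
    rw [mem_orderComplex] at h1
    refine ⟨D.preimage f f.injective.injOn, mem_orderComplex.2 ?_, ?_⟩
    · intro a ha b hb hab
      simp only [Finset.coe_preimage, Set.mem_preimage] at ha hb
      have := h1 ha hb (fun h => hab (f.injective h))
      simpa using this
    · ext x
      simp only [Finset.mem_map, Finset.mem_preimage]
      constructor
      · rintro ⟨a, ha, rfl⟩; exact ha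
      · intro hx
        obtain ⟨a, rfl⟩ := h2 x hx
        exact ⟨a, hx, rfl⟩
  · intro C _
    simp

theorem chainSum_congr (e : P ≃o Q) (y : ℝ) : chainSum P y = chainSum Q y := by
  classical
  rw [chainSum_of_orderEmbedding e.toOrderEmbedding, chainSum, Finset.filter_true_of_mem]
  intro C _ c _
  exact ⟨e.symm c, by simp⟩

open scoped Classical in
/-- The chains of `P` all of whose elements are greater than `p`. -/
noncomputable def chainsAbove (p : P) : Finset (Finset P) :=
  (orderComplex P).filter fun C => ∀ c ∈ C, p < c

theorem mem_chainsAbove {p : P} {C : Finset P} :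
    C ∈ chainsAbove p ↔ IsChain (· ≤ ·) (C : Set P) ∧ ∀ c ∈ C, p < c := by
  classical rw [chainsAbove, Finset.mem_filter, mem_orderComplex]

open scoped Classical in
theorem sum_chains_Ici (p : P) (y : ℝ) :
    ∑ C ∈ (orderComplex P).filter (fun C => ∀ c ∈ C, p ≤ c), y ^ C.card =
      (1 + y) * ∑ C ∈ chainsAbove p, y ^ C.card := by
  rw [add_mul, one_mul, Finset.mul_sum,
    ← Finset.sum_filter_add_sum_filter_not _ (fun C => p ∉ C)]
  congr 1
  · refine Finset.sum_congr ?_ fun _ _ => rfl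
    ext C
    simp only [Finset.mem_filter, mem_chainsAbove, mem_orderComplex]
    constructor
    · rintro ⟨⟨h1, h2⟩, h3⟩
      exact ⟨h1, fun c hc => (h2 c hc).lt_of_ne fun h => h3 (h ▸ hc)⟩
    · rintro ⟨h1, h2⟩
      exact ⟨⟨h1, fun c hc => (h2 c hc).le⟩, fun h => lt_irrefl _ (h2 p h)⟩
  · refine Finset.sum_bij' (fun C _ => C.erase p) (fun C _ => insert p C) ?_ ?_ ?_ ?_ ?_
    · intro C hC
      simp only [Finset.mem_filter, mem_orderComplex, not_not] at hC
      refine mem_chainsAbove.2 ⟨hC.1.1.mono (by simp), fun c hc => ?_⟩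
      exact (hC.1.2 c (Finset.mem_of_mem_erase hc)).lt_of_ne (Finset.ne_of_mem_erase hc).symm
    · intro C hC
      obtain ⟨h1, h2⟩ := mem_chainsAbove.1 hC
      simp only [Finset.mem_filter, mem_orderComplex, not_not]
      refine ⟨⟨?_, ?_⟩, by simp⟩
      · rw [Finset.coe_insert]
        exact h1.insert fun b hb _ => Or.inl (h2 b hb).le
      · simp only [Finset.mem_insert]
        rintro c (rfl | hc)
        exacts [le_rfl, (h2 c hc).le]
    · intro C hC
      simp only [Finset.mem_filter, not_not] at hC
      exact Finset.insert_erase hC.2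
    · intro C hC
      exact Finset.erase_insert fun h => lt_irrefl _ ((mem_chainsAbove.1 hC).2 p h)
    · intro C hC
      simp only [Finset.mem_filter, not_not] at hC
      rw [← pow_succ', Finset.card_erase_add_one hC.2]

open scoped Classical in
theorem sum_chainsAbove (p : P) (y : ℝ) : ∑ C ∈ chainsAbove p, y ^ C.card =
    1 + ∑ q ∈ Finset.univ.filter (fun q => p < q), y * ∑ C ∈ chainsAbove q, y ^ C.card := by
  have h0 : ∅ ∈ chainsAbove p := mem_chainsAbove.2 ⟨by simp, by simp⟩
  rw [← Finset.add_sum_erase _ _ h0, Finset.card_empty, pow_zero]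
  congr 1
  simp only [Finset.mul_sum]
  rw [Finset.sum_sigma']
  symm
  refine Finset.sum_bij (fun x _ => insert x.1 x.2) ?_ ?_ ?_ ?_
  · rintro ⟨q, C⟩ h
    simp only [Finset.mem_sigma, Finset.mem_filter, Finset.mem_univ, true_and,
      mem_chainsAbove] at h
    obtain ⟨hq, h1, h2⟩ := h
    refine Finset.mem_erase.2 ⟨Finset.insert_ne_empty _ _, mem_chainsAbove.2 ⟨?_, ?_⟩⟩
    · rw [Finset.coe_insert]
      exact h1.insert fun b hb _ => Or.inl (h2 b hb).le
    · simp only [Finset.mem_insert]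
      rintro c (rfl | hc)
      exacts [hq, hq.trans (h2 c hc)]
  · rintro ⟨q, C⟩ h ⟨q', C'⟩ h' heq
    simp only [Finset.mem_sigma, Finset.mem_filter, Finset.mem_univ, true_and,
      mem_chainsAbove] at h h'
    simp only at heq
    have hqq : q = q' := by
      have m1 : q ∈ insert q' C' := heq ▸ Finset.mem_insert_self q C
      have m2 : q' ∈ insert q C := heq ▸ Finset.mem_insert_self q' C'
      rcases Finset.mem_insert.1 m1 with e | m1
      · exact e
      rcases Finset.mem_insert.1 m2 with e | m2
      · exact e.symm
      exact absurd ((h'.2.2 q m1).trans (h.2.2 q' m2)) (lt_irrefl _)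
    subst hqq
    have hn : q ∉ C := fun hm => lt_irrefl _ (h.2.2 q hm)
    have hn' : q ∉ C' := fun hm => lt_irrefl _ (h'.2.2 q hm)
    rw [← Finset.erase_insert hn, heq, Finset.erase_insert hn']
  · intro D hD
    obtain ⟨hne, hD⟩ := Finset.mem_erase.1 hD
    obtain ⟨h1, h2⟩ := mem_chainsAbove.1 hD
    obtain ⟨q, hq, hmin⟩ := Finset.exists_minimal (Finset.nonempty_iff_ne_empty.2 hne)
    refine ⟨⟨q, D.erase q⟩, ?_, Finset.insert_erase hq⟩
    simp only [Finset.mem_sigma, Finset.mem_filter, Finset.mem_univ, true_and, mem_chainsAbove]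
    refine ⟨h2 q hq, h1.mono (by simp), fun c hc => ?_⟩
    obtain ⟨hcq, hc⟩ := Finset.mem_erase.1 hc
    rcases h1 hq hc hcq.symm with h | h
    · exact h.lt_of_ne hcq.symm
    · exact (hmin hc h).lt_of_ne hcq.symm
  · rintro ⟨q, C⟩ h
    simp only [Finset.mem_sigma, mem_chainsAbove] at h
    rw [Finset.card_insert_of_notMem fun hm => lt_irrefl _ (h.2.2 q hm), pow_succ']

open scoped Classical in
/-- The recursion for chain polynomials of posets with a least element, in which `F q` is the chain
polynomial of the principal filter generated by `q`. -/
theorem chainSum_recurrence {b : P} (hb : ∀ p, b ≤ p) (y : ℝ) (F : P → ℝ)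
    (hF : ∀ q, q ≠ b → F q =
      ∑ C ∈ (orderComplex P).filter (fun C => ∀ c ∈ C, q ≤ c), y ^ C.card) :
    chainSum P y = (1 + y) + y * (∑ q, F q - F b) := by
  have h1 : chainSum P y = (1 + y) * ∑ C ∈ chainsAbove b, y ^ C.card := by
    rw [← sum_chains_Ici, chainSum, Finset.filter_true_of_mem]
    exact fun C _ c _ => hb c
  have h2 : Finset.univ.filter (fun q => b < q) = Finset.univ.erase b := by
    ext q
    simp only [Finset.mem_filter, Finset.mem_univ, true_and, Finset.mem_erase, and_true]
    exact ⟨fun h => h.ne', fun h => (hb q).lt_of_ne h.symm⟩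
  have h3 : ∑ q ∈ Finset.univ.erase b, F q =
      ∑ q ∈ Finset.univ.erase b, (1 + y) * ∑ C ∈ chainsAbove q, y ^ C.card := by
    refine Finset.sum_congr rfl fun q hq => ?_
    rw [hF q (Finset.ne_of_mem_erase hq), sum_chains_Ici]
  rw [← Finset.add_sum_erase _ _ (Finset.mem_univ b), add_sub_cancel_left, h1, sum_chainsAbove, h2,
    h3, ← Finset.mul_sum, ← Finset.mul_sum]
  ring

end ChainSum

/-- A set with an involution whose only fixed point is `0`. -/
class SignedSet (V : Type) extends Zero V, InvolutiveNeg V where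
  neg_eq_self_iff : ∀ v : V, -v = v ↔ v = 0

namespace SignedSet

variable {V : Type} [SignedSet V]

theorem neg_zero' : -(0 : V) = 0 := (neg_eq_self_iff _).2 rfl

theorem odd_card [Finite V] : Odd (Nat.card V) := by
  classical
  have := Fintype.ofFinite V
  have h := Equiv.Perm.card_fixedPoints_modEq (α := V) (f := fun v => -v) (p := 2) (n := 1) <| by
    funext v
    exact neg_neg v
  have h1 : Fintype.card (Function.fixedPoints fun v : V => -v) = 1 := by
    rw [Fintype.card_eq_one_iff]
    exact ⟨⟨0, neg_zero'⟩, fun v => Subtype.ext ((neg_eq_self_iff _).1 v.2)⟩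
  rw [Nat.card_eq_fintype_card, Nat.odd_iff]
  rw [h1] at h
  exact h

instance : SignedSet (V ⊕ Bool) where
  zero := Sum.inl 0
  neg := Sum.map (fun v => -v) not
  neg_neg := by
    rintro (v | b)
    · exact congrArg Sum.inl (neg_neg v)
    · exact congrArg Sum.inr (Bool.not_not b)
  neg_eq_self_iff := by
    rintro (v | b)
    · exact (Sum.inl_injective.eq_iff).trans ((neg_eq_self_iff v).trans Sum.inl_injective.eq_iff.symm)
    · exact ⟨fun h => absurd (Sum.inr_injective h) (by simp), fun h => by cases h⟩

end SignedSet

open SignedSet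

/-- The partitions of a signed set which are invariant under negation and in which a block with two
opposite elements contains `0`, ordered by refinement. -/
abbrev SignedPartition (V : Type) [SignedSet V] : Type :=
  {r : Setoid V // (∀ a b, r a b → r (-a) (-b)) ∧ ∀ a, r a (-a) → r a 0}

noncomputable instance (V : Type) [SignedSet V] [Finite V] : Fintype (SignedPartition V) :=
  have : Finite (Setoid V) := Finite.of_injective (fun r : Setoid V => (r : V → V → Prop))
    fun _ _ h => Setoid.ext fun a b => iff_of_eq (congrFun (congrFun h a) b)
  Fintype.ofFinite _

namespace SignedPartition

variable {V : Type} [SignedSet V]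

instance (r : SignedPartition V) : SignedSet (Quotient r.1) where
  zero := Quotient.mk r.1 0
  neg := Quotient.map (fun v => -v) r.2.1
  neg_neg := by
    rintro ⟨v⟩
    exact congrArg (Quotient.mk r.1) (neg_neg v)
  neg_eq_self_iff := by
    rintro ⟨v⟩
    constructor
    · intro h
      exact Quotient.sound (r.2.2 v (r.1.symm (Quotient.exact h)))
    · intro h
      have h0 : r.1 v 0 := Quotient.exact h
      have h1 := r.2.1 _ _ h0
      rw [neg_zero'] at h1
      exact Quotient.sound (r.1.trans h1 (r.1.symm h0))

theorem rel_neg_iff (r : SignedPartition V) {a b : V} : r.1 (-a) b ↔ r.1 a (-b) :=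
  ⟨fun h => by simpa using r.2.1 _ _ h, fun h => by simpa using r.2.1 _ _ h⟩

theorem rel_neg_self_iff (r : SignedPartition V) {a : V} : r.1 a (-a) ↔ r.1 a 0 := by
  refine ⟨r.2.2 a, fun h => r.1.trans h ?_⟩
  have := r.2.1 _ _ h
  rw [neg_zero'] at this
  exact r.1.symm this

/-- The kernel of an odd map. -/
def ker {T : Type} [SignedSet T] (κ : V → T) (hκ : ∀ v, κ (-v) = -κ v) : SignedPartition V :=
  ⟨Setoid.ker κ, fun a b h => by
    rw [Setoid.ker_def] at h ⊢
    rw [hκ, hκ, h], fun a h => by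
    rw [Setoid.ker_def] at h ⊢
    have h0 : κ 0 = 0 := by
      rw [← neg_eq_self_iff, ← hκ, neg_zero']
    rw [hκ] at h
    rw [h0, ← neg_eq_self_iff, ← h]⟩

theorem card_quotient_ker {T : Type} [SignedSet T] {κ : V → T} {hκ : ∀ v, κ (-v) = -κ v}
    (hs : Function.Surjective κ) : Nat.card (Quotient (ker κ hκ).1) = Nat.card T :=
  Nat.card_congr (Setoid.quotientKerEquivOfSurjective κ hs)

/-- The signed partitions of the quotient by `r` as the principal filter generated by `r`. -/
def ofQuotient (r : SignedPartition V) : SignedPartition (Quotient r.1) ↪o SignedPartition V where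
  toFun s := ⟨Setoid.comap (Quotient.mk r.1) s.1, fun _ _ h => s.2.1 _ _ h, fun _ h => s.2.2 _ h⟩
  inj' s s' h := Subtype.ext <| Setoid.ext fun x y => by
    induction x using Quotient.inductionOn
    induction y using Quotient.inductionOn
    exact iff_of_eq (congrArg (fun z : SignedPartition V => z.1 _ _) h)
  map_rel_iff' {s s'} := by
    refine ⟨fun h x y => ?_, fun h x y => fun hs => h hs⟩
    induction x using Quotient.inductionOn
    induction y using Quotient.inductionOn
    exact fun hs => h hs

theorem mem_range_ofQuotient {r s : SignedPartition V} : s ∈ Set.range (ofQuotient r) ↔ r ≤ s := by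
  constructor
  · rintro ⟨s, rfl⟩ a b h
    change s.1 (Quotient.mk r.1 a) (Quotient.mk r.1 b)
    rw [Quotient.sound h]
  · intro h
    refine ⟨⟨Setoid.correspondence r.1 ⟨s.1, h⟩, ?_, ?_⟩, ?_⟩
    · rintro ⟨a⟩ ⟨b⟩ hab
      exact s.2.1 a b hab
    · rintro ⟨a⟩ ha
      exact s.2.2 a ha
    · rfl

/-- The partition into singletons. -/
def discrete (V : Type) [SignedSet V] : SignedPartition V :=
  ⟨⊥, fun _ _ h => congrArg _ h, fun _ h => (neg_eq_self_iff _).1 h.symm⟩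

theorem discrete_le (r : SignedPartition V) : discrete V ≤ r := bot_le (a := r.1)

/-- The number of pairs of opposite nonzero blocks. -/
noncomputable def rank (r : SignedPartition V) : ℕ := Nat.card (Quotient r.1) / 2

theorem card_quotient [Finite V] (r : SignedPartition V) :
    Nat.card (Quotient r.1) = 2 * rank r + 1 := by
  have := Nat.odd_iff.1 (odd_card (V := Quotient r.1))
  rw [rank]
  omega

theorem rank_discrete {n : ℕ} (h : Nat.card V = 2 * n + 1) : rank (discrete V) = n := by
  have : Nat.card (Quotient (discrete V).1) = Nat.card V :=
    Nat.card_congr Setoid.quotientBotEquiv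
  rw [rank, this, h]
  omega

theorem rank_lt_of_lt [Finite V] {r s : SignedPartition V} (h : r < s) : rank s < rank r := by
  have hf : Function.Surjective (Quotient.map' (s₁ := r.1) (s₂ := s.1) id h.le) := by
    rintro ⟨v⟩
    exact ⟨Quotient.mk _ v, rfl⟩
  have hle := Nat.card_le_card_of_surjective _ hf
  have hne : Nat.card (Quotient s.1) ≠ Nat.card (Quotient r.1) := by
    intro he
    have hb := (Nat.bijective_iff_surjective_and_card _).2 ⟨hf, he.symm⟩
    refine h.not_ge fun a b hab => ?_
    exact Quotient.exact (hb.1 (a₁ := Quotient.mk r.1 a) (a₂ := Quotient.mk r.1 b)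
      (Quotient.sound (s := s.1) hab))
  have h1 := card_quotient r
  have h2 := card_quotient s
  omega

section Extension

variable {a : V} (ha : a ≠ 0)

/-- The signed set obtained by removing a pair of nonzero opposite elements. -/
@[ext]
structure Removed {a : V} (ha : a ≠ 0) where
  /-- The underlying element of the ambient signed set. -/
  val : V
  ne : val ≠ a
  ne_neg : val ≠ -a

namespace Removed

instance : Zero (Removed ha) :=
  ⟨⟨0, ha.symm, fun h => ha (by rw [← neg_neg a, ← h, neg_zero'])⟩⟩

instance : Neg (Removed ha) :=
  ⟨fun v => ⟨-v.1, fun h => v.ne_neg (by rw [← neg_neg v.1, h]), fun h => v.ne (neg_injective h)⟩⟩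

instance : SignedSet (Removed ha) where
  neg_neg v := Removed.ext (neg_neg v.1)
  neg_eq_self_iff v := by
    rw [Removed.ext_iff, Removed.ext_iff]
    exact neg_eq_self_iff v.1

theorem val_injective : Function.Injective (val : Removed ha → V) := fun _ _ h => Removed.ext h

instance [Finite V] : Finite (Removed ha) := Finite.of_injective _ (val_injective ha)

end Removed

open Removed

theorem card_removed [Finite V] : Nat.card V = Nat.card (Removed ha) + 2 := by
  classical
  have h1 : -a ≠ a := fun h => ha ((neg_eq_self_iff a).1 h)
  let f : Removed ha ⊕ Bool → V := Sum.elim val fun b => if b then a else -a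
  have hf : Function.Bijective f := by
    constructor
    · rintro (v | _ | _) (w | _ | _) h
      · exact congrArg Sum.inl (val_injective ha h)
      · exact absurd h v.ne_neg
      · exact absurd h v.ne
      · exact absurd h.symm w.ne_neg
      · rfl
      · exact absurd h h1
      · exact absurd h.symm w.ne
      · exact absurd h.symm h1
      · rfl
    · intro x
      by_cases hx : x = a
      · exact ⟨Sum.inr true, hx.symm⟩
      by_cases hx' : x = -a
      exacts [⟨Sum.inr false, hx'.symm⟩, ⟨Sum.inl ⟨x, hx, hx'⟩, rfl⟩]
  rw [← Nat.card_eq_of_bijective f hf, Nat.card_sum]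
  simp

/-- Restriction of a signed partition. -/
def restrict (r : SignedPartition V) : SignedPartition (Removed ha) :=
  ⟨Setoid.comap val r.1, fun x y h => by
    rw [Setoid.comap_rel] at h ⊢
    exact r.2.1 _ _ h, fun x h => by
    rw [Setoid.comap_rel] at h ⊢
    exact r.2.2 _ h⟩

theorem restrict_rel (r : SignedPartition V) (x y : Removed ha) :
    (restrict ha r).1 x y ↔ r.1 x.1 y.1 := Iff.rfl

theorem ext_of_restrict {r s : SignedPartition V} (h : restrict ha r = restrict ha s)
    (h' : ∀ v : Removed ha, r.1 a v.1 ↔ s.1 a v.1) : r = s := by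
  have h0 : r.1 a 0 ↔ s.1 a 0 := h' 0
  have hr : ∀ x y : Removed ha, r.1 x.1 y.1 ↔ s.1 x.1 y.1 := fun x y => by
    rw [← restrict_rel, ← restrict_rel, h]
  have hn : ∀ v : Removed ha, r.1 (-a) v.1 ↔ s.1 (-a) v.1 := fun v => by
    rw [rel_neg_iff, rel_neg_iff]
    exact h' (-v)
  have haa : r.1 a (-a) ↔ s.1 a (-a) := by rw [rel_neg_self_iff, rel_neg_self_iff, h0]
  have hcase : ∀ x : V, x = a ∨ x = -a ∨ ∃ v : Removed ha, v.1 = x := by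
    intro x
    by_cases h1 : x = a
    · exact Or.inl h1
    by_cases h2 : x = -a
    exacts [Or.inr (Or.inl h2), Or.inr (Or.inr ⟨⟨x, h1, h2⟩, rfl⟩)]
  refine Subtype.ext (Setoid.ext fun x y => ?_)
  rcases hcase x with rfl | rfl | ⟨v, rfl⟩ <;> rcases hcase y with rfl | rfl | ⟨w, rfl⟩
  · exact iff_of_true (r.1.refl _) (s.1.refl _)
  · exact haa
  · exact h' w
  · rw [r.1.comm', s.1.comm']
    exact haa
  · exact iff_of_true (r.1.refl _) (s.1.refl _)
  · exact hn w
  · rw [r.1.comm', s.1.comm']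
    exact h' v
  · rw [r.1.comm', s.1.comm']
    exact hn v
  · exact hr v w

open scoped Classical in
/-- The odd extension of an odd map. -/
noncomputable def oddExtend {T : Type} [SignedSet T] (κ : Removed ha → T) (τ : T) (v : V) : T :=
  if h : v = a then τ else if h' : v = -a then -τ else κ ⟨v, h, h'⟩

variable {ha}

theorem oddExtend_val {T : Type} [SignedSet T] (κ : Removed ha → T) (τ : T) (v : Removed ha) :
    oddExtend ha κ τ v.1 = κ v := by
  rw [oddExtend, dif_neg v.ne, dif_neg v.ne_neg]

theorem oddExtend_self {T : Type} [SignedSet T] (κ : Removed ha → T) (τ : T) :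
    oddExtend ha κ τ a = τ := by
  rw [oddExtend, dif_pos rfl]

theorem oddExtend_neg_self {T : Type} [SignedSet T] (κ : Removed ha → T) (τ : T) :
    oddExtend ha κ τ (-a) = -τ := by
  rw [oddExtend, dif_neg (fun h => ha ((neg_eq_self_iff a).1 h)), dif_pos rfl]

theorem oddExtend_neg {T : Type} [SignedSet T] {κ : Removed ha → T} (hκ : ∀ v, κ (-v) = -κ v)
    (τ : T) (v : V) : oddExtend ha κ τ (-v) = -oddExtend ha κ τ v := by
  by_cases h1 : v = a
  · rw [h1, oddExtend_self, oddExtend_neg_self]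
  by_cases h2 : v = -a
  · rw [h2, neg_neg, oddExtend_self, oddExtend_neg_self, neg_neg]
  let w : Removed ha := ⟨v, h1, h2⟩
  change oddExtend ha κ τ (-w).val = -oddExtend ha κ τ w.val
  rw [oddExtend_val, oddExtend_val, hκ]

/-- The signed partitions restricting to `r`: the new pair of elements consists of two singletons,
or is added to a pair of opposite blocks of `r`. -/
noncomputable def extend (r : SignedPartition (Removed ha)) :
    Option (Quotient r.1) → SignedPartition V
  | none => ker (oddExtend ha (fun v => (Sum.inl (Quotient.mk r.1 v) : Quotient r.1 ⊕ Bool))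
      (Sum.inr true)) 
      (oddExtend_neg (κ := fun v => (Sum.inl (Quotient.mk r.1 v) : Quotient r.1 ⊕ Bool))
        (fun _ => rfl) _)
  | some q => ker (oddExtend ha (Quotient.mk r.1) q)
      (oddExtend_neg (κ := Quotient.mk r.1) (fun _ => rfl) _)

theorem extend_none_rel (r : SignedPartition (Removed ha)) (x y : V) :
    (extend r none).1 x y ↔
      oddExtend ha (fun v => (Sum.inl (Quotient.mk r.1 v) : Quotient r.1 ⊕ Bool)) (Sum.inr true) x =
      oddExtend ha (fun v => (Sum.inl (Quotient.mk r.1 v) : Quotient r.1 ⊕ Bool)) (Sum.inr true) y :=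
  Iff.rfl

theorem extend_some_rel (r : SignedPartition (Removed ha)) (q : Quotient r.1) (x y : V) :
    (extend r (some q)).1 x y ↔
      oddExtend ha (Quotient.mk r.1) q x = oddExtend ha (Quotient.mk r.1) q y :=
  Iff.rfl

theorem restrict_extend (r : SignedPartition (Removed ha)) (o : Option (Quotient r.1)) :
    restrict ha (extend r o) = r := by
  refine Subtype.ext (Setoid.ext fun x y => ?_)
  rw [restrict_rel]
  cases o with
  | none =>
    rw [extend_none_rel, oddExtend_val, oddExtend_val, Sum.inl_injective.eq_iff]
    exact Quotient.eq
  | some q =>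
    rw [extend_some_rel, oddExtend_val, oddExtend_val]
    exact Quotient.eq

theorem extend_rel (r : SignedPartition (Removed ha)) (o : Option (Quotient r.1))
    (v : Removed ha) : (extend r o).1 a v.1 ↔ o = some (Quotient.mk r.1 v) := by
  cases o with
  | none =>
    rw [extend_none_rel, oddExtend_val, oddExtend_self]
    simp
  | some q =>
    rw [extend_some_rel, oddExtend_val, oddExtend_self, Option.some_inj]

theorem extend_bijective : Function.Bijective
    fun x : Σ r : SignedPartition (Removed ha), Option (Quotient r.1) => extend x.1 x.2 := by
  constructor
  · rintro ⟨r, o⟩ ⟨s, p⟩ h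
    have hrs : r = s := by
      have := congrArg (restrict ha) h
      simpa only [restrict_extend] using this
    subst hrs
    have ho : ∀ q, o = some q ↔ p = some q := by
      rintro ⟨v⟩
      have h1 := extend_rel r o v
      have h2 := extend_rel r p v
      have h3 : extend r o = extend r p := h
      rw [h3] at h1
      exact h1.symm.trans h2
    rw [Option.ext ho]
  · intro r
    by_cases h : ∃ v : Removed ha, r.1 a v.1
    · obtain ⟨v, hv⟩ := h
      refine ⟨⟨restrict ha r, some (Quotient.mk _ v)⟩, ext_of_restrict ha (restrict_extend _ _) ?_⟩
      intro w
      rw [extend_rel, Option.some_inj]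
      exact ⟨fun h => r.1.trans' hv (Quotient.exact (s := (restrict ha r).1) h),
        fun h => Quotient.sound (s := (restrict ha r).1) (r.1.trans' (r.1.symm' hv) h)⟩
    · push Not at h
      refine ⟨⟨restrict ha r, none⟩, ext_of_restrict ha (restrict_extend _ _) ?_⟩
      intro w
      rw [extend_rel]
      simpa using h w

theorem rank_extend_some (r : SignedPartition (Removed ha)) (q : Quotient r.1) :
    rank (extend r (some q)) = rank r := by
  rw [rank, rank, extend, card_quotient_ker]
  rintro ⟨v⟩
  exact ⟨v.1, oddExtend_val _ _ v⟩

theorem rank_extend_none [Finite V] (r : SignedPartition (Removed ha)) :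
    rank (extend r none) = rank r + 1 := by
  rw [rank, rank, extend, card_quotient_ker, Nat.card_sum]
  · simp
  · rintro (q | _ | _)
    · obtain ⟨v, rfl⟩ := Quotient.exists_rep q
      exact ⟨v.1, oddExtend_val _ _ v⟩
    exacts [⟨-a, oddExtend_neg_self _ _⟩, ⟨a, oddExtend_self _ _⟩]

theorem sum_rank_removed [Finite V] (φ : ℕ → ℝ) : ∑ r : SignedPartition V, φ (rank r) =
    ∑ r : SignedPartition (Removed ha), blockShift φ (rank r) := by
  classical
  have (r : SignedPartition (Removed ha)) : Fintype (Quotient r.1) := Fintype.ofFinite _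
  rw [← Fintype.sum_bijective _ (extend_bijective (ha := ha)) (fun x => φ (rank (extend x.1 x.2)))
    _ fun _ => rfl, Fintype.sum_sigma]
  refine Finset.sum_congr rfl fun r _ => ?_
  rw [Fintype.sum_option]
  simp only [rank_extend_some, rank_extend_none, Finset.sum_const, Finset.card_univ, nsmul_eq_mul,
    ← Nat.card_eq_fintype_card, card_quotient]
  rw [blockShift]
  push_cast
  rfl

end Extension

theorem sum_rank (n : ℕ) : ∀ (V : Type) [SignedSet V] [Finite V], Nat.card V = 2 * n + 1 →
    ∀ φ : ℕ → ℝ, ∑ r : SignedPartition V, φ (rank r) = (blockShift^[n] φ) 0 := by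
  induction n with
  | zero =>
    intro V _ _ hV φ
    have := (Nat.card_eq_one_iff_unique.1 hV).1
    have hu : ∀ r : SignedPartition V, r = discrete V := fun r => Subtype.ext <|
      Setoid.ext fun x y => by
        rw [Subsingleton.elim x y]
        exact iff_of_true (r.1.refl _) ((discrete V).1.refl _)
    rw [Fintype.sum_eq_single (discrete V) fun r hr => absurd (hu r) hr, rank_discrete hV]
    rfl
  | succ n ih =>
    intro V _ _ hV φ
    obtain ⟨a, ha⟩ : ∃ a : V, a ≠ 0 := by
      by_contra! h
      have : Subsingleton V := ⟨fun x y => by rw [h x, h y]⟩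
      have := Finite.card_le_one_iff_subsingleton.2 this
      omega
    rw [sum_rank_removed (ha := ha), ih _ (by have := card_removed ha; omega),
      Function.iterate_succ_apply]

open Polynomial in
theorem chainSum_eq {t : ℝ} (ht : 1 - t ≠ 0) (n : ℕ) : ∀ (V : Type) [SignedSet V] [Finite V],
    Nat.card V = 2 * n + 1 → chainSum (SignedPartition V) (t / (1 - t)) =
      (1 + t / (1 - t)) * ((hRefined n 0).eval t / (1 - t) ^ n) := by
  classical
  induction n using Nat.strong_induction_on with
  | _ n ih =>
    intro V _ _ hV
    set u : ℕ → ℝ := fun k => (hRefined k 0).eval t / (1 - t) ^ k with hu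
    rw [chainSum_recurrence discrete_le (t / (1 - t))
      (fun r => (1 + t / (1 - t)) * u (rank r)) ?_]
    · have h1 := sum_rank n V hV u
      have h2 := eval_hRefined_recurrence ht n
      rw [← hu, ← h1] at h2
      rw [← Finset.mul_sum, rank_discrete hV]
      have h3 : (hRefined n 0).eval t / (1 - t) ^ n = u n := rfl
      rw [h3] at h2 ⊢
      linear_combination -h2 * (1 + t / (1 - t))
    · intro r hr
      have hlt : rank r < n := by
        rw [← rank_discrete hV]
        exact rank_lt_of_lt ((discrete_le r).lt_of_ne hr.symm)
      rw [← ih _ hlt (Quotient r.1) (card_quotient r), chainSum_of_orderEmbedding (ofQuotient r)]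
      simp only [mem_range_ofQuotient]
      congr

end SignedPartition

open SignedSet SignedPartition

/-- The signed set `{-n, …, n}`. -/
noncomputable instance (n : ℕ) : SignedSet (Finset.Icc (-(n : ℤ)) (n : ℤ)) where
  zero := ⟨0, by simp⟩
  neg v := ⟨-v.1, by have := Finset.mem_Icc.1 v.2; exact Finset.mem_Icc.2 (by omega)⟩
  neg_neg v := Subtype.ext (neg_neg v.1)
  neg_eq_self_iff v := by
    rw [Subtype.ext_iff, Subtype.ext_iff]
    change -v.1 = v.1 ↔ v.1 = 0
    omega

namespace PiB

variable {n : ℕ}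

theorem coe_neg (v : Finset.Icc (-(n : ℤ)) (n : ℤ)) : (-v).1 = -v.1 := rfl

theorem coe_zero : (0 : Finset.Icc (-(n : ℤ)) (n : ℤ)).1 = 0 := rfl

theorem part_neg (π : PiB n) (a : Finset.Icc (-(n : ℤ)) (n : ℤ)) :
    π.1.part (-a).1 = (π.1.part a.1).image fun i => -i :=
  π.1.part_eq_of_mem (π.2.1 _ (π.1.part_mem.2 a.2))
    (Finset.mem_image.2 ⟨a.1, π.1.mem_part_self.2 a.2, rfl⟩)

/-- The equivalence relation attached to a type `B` partition. -/
noncomputable def toSigned (π : PiB n) : SignedPartition (Finset.Icc (-(n : ℤ)) (n : ℤ)) :=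
  ⟨Setoid.ker fun a => π.1.part a.1, fun a b h => by
    rw [Setoid.ker_def] at h ⊢
    rw [part_neg, part_neg, h], fun a h => by
    rw [Setoid.ker_def] at h ⊢
    have h1 : a.1 ∈ π.1.part a.1 := π.1.mem_part_self.2 a.2
    have h2 : -a.1 ∈ π.1.part a.1 := by
      rw [h]
      exact π.1.mem_part_self.2 (-a).2
    have hp := π.1.part_mem.2 a.2
    have ha := Finset.mem_Icc.1 a.2
    have h0 : (0 : ℤ) ∈ π.1.part a.1 := by
      rcases lt_trichotomy a.1 0 with h | h | h
      · exact π.2.2 _ hp (-a.1) (Finset.mem_Icc.2 (by omega)) h2 (by rwa [neg_neg])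
      · rwa [h] at h1 ⊢
      · exact π.2.2 _ hp a.1 (Finset.mem_Icc.2 (by omega)) h1 h2
    exact (π.1.part_eq_of_mem hp h0).symm⟩

theorem toSigned_rel (π : PiB n) (a b : Finset.Icc (-(n : ℤ)) (n : ℤ)) :
    (toSigned π).1 a b ↔ π.1.part a.1 = π.1.part b.1 := Iff.rfl

theorem toSigned_le_iff (π π' : PiB n) : toSigned π ≤ toSigned π' ↔ π ≤ π' := by
  constructor
  · intro h B hB
    obtain ⟨x, hx⟩ := π.1.nonempty_of_mem_parts hB
    have hxI := π.1.le hB hx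
    refine ⟨π'.1.part x, π'.1.part_mem.2 hxI, fun y hy => ?_⟩
    have hyI := π.1.le hB hy
    have hxy : (toSigned π).1 ⟨x, hxI⟩ ⟨y, hyI⟩ := by
      rw [toSigned_rel, π.1.part_eq_of_mem hB hx, π.1.part_eq_of_mem hB hy]
    have := (toSigned_rel _ _ _).1 (h hxy)
    rw [this]
    exact π'.1.mem_part_self.2 hyI
  · intro h a b hab
    rw [toSigned_rel] at hab ⊢
    obtain ⟨C, hC, hle⟩ := h (π.1.part_mem.2 a.2)
    rw [π'.1.part_eq_of_mem hC (hle (π.1.mem_part_self.2 a.2)),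
      π'.1.part_eq_of_mem hC (hle (hab ▸ π.1.mem_part_self.2 b.2))]

theorem toSigned_surjective : Function.Surjective (toSigned (n := n)) := by
  classical
  intro r
  let g : ℤ → Option (Quotient r.1) := fun x =>
    if h : x ∈ Finset.Icc (-(n : ℤ)) (n : ℤ) then some (Quotient.mk r.1 ⟨x, h⟩) else none
  have hg : ∀ a : Finset.Icc (-(n : ℤ)) (n : ℤ), g a.1 = some (Quotient.mk r.1 a) := fun a => by
    simp only [g, dif_pos a.2]
  let π := Finpartition.ofSetSetoid (Setoid.ker g) (Finset.Icc (-(n : ℤ)) (n : ℤ))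
  have hmem : ∀ a b : Finset.Icc (-(n : ℤ)) (n : ℤ), b.1 ∈ π.part a.1 ↔ r.1 a b := by
    intro a b
    rw [Finpartition.mem_part_ofSetSetoid_iff_rel, Setoid.ker_def, hg, hg, Option.some_inj,
      Quotient.eq]
    exact ⟨fun h => h.2.2, fun h => ⟨a.2, b.2, h⟩⟩
  have hpart : ∀ B ∈ π.parts, ∃ a : Finset.Icc (-(n : ℤ)) (n : ℤ), B = π.part a.1 := by
    intro B hB
    obtain ⟨x, hx⟩ := π.nonempty_of_mem_parts hB
    exact ⟨⟨x, π.le hB hx⟩, (π.part_eq_of_mem hB hx).symm⟩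
  have hπ : (∀ B ∈ π.parts, B.image (fun i => -i) ∈ π.parts) ∧
      (∀ B ∈ π.parts, ∀ i ∈ Finset.Icc (1 : ℤ) (n : ℤ), i ∈ B → -i ∈ B → (0 : ℤ) ∈ B) := by
    constructor
    · intro B hB
      obtain ⟨a, rfl⟩ := hpart B hB
      have : (π.part a.1).image (fun i => -i) = π.part (-a).1 := by
        ext x
        rw [Finset.mem_image]
        constructor
        · rintro ⟨y, hy, rfl⟩
          have hyI := π.part_subset _ hy
          exact (hmem (-a) (-⟨y, hyI⟩)).2 (r.2.1 _ _ ((hmem a ⟨y, hyI⟩).1 hy))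
        · intro hx
          have hxI := π.part_subset _ hx
          have h1 := r.2.1 _ _ ((hmem (-a) ⟨x, hxI⟩).1 hx)
          rw [neg_neg] at h1
          exact ⟨-x, (hmem a (-⟨x, hxI⟩)).2 h1, neg_neg x⟩
      rw [this]
      exact π.part_mem.2 (-a).2
    · intro B hB i _ hi hi'
      obtain ⟨a, rfl⟩ := hpart B hB
      have hiI := π.part_subset _ hi
      have h1 := (hmem a ⟨i, hiI⟩).1 hi
      have h2 := (hmem a (-⟨i, hiI⟩)).1 hi'
      exact (hmem a 0).2 (r.1.trans' h1 (r.2.2 _ (r.1.trans' (r.1.symm' h1) h2)))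
  refine ⟨⟨π, hπ⟩, Subtype.ext (Setoid.ext fun a b => ?_)⟩
  rw [toSigned_rel, ← hmem]
  change π.part a.1 = π.part b.1 ↔ _
  rw [eq_comm]
  exact (π.mem_part_iff_part_eq_part b.2 a.2).symm

/-- The type `B` partition lattice as a lattice of equivalence relations. -/
noncomputable def orderIso (n : ℕ) :
    PiB n ≃o SignedPartition (Finset.Icc (-(n : ℤ)) (n : ℤ)) :=
  OrderIso.ofSurjective (OrderEmbedding.ofMapLEIff toSigned toSigned_le_iff) toSigned_surjective

theorem card_Icc (n : ℕ) : Nat.card (Finset.Icc (-(n : ℤ)) (n : ℤ)) = 2 * n + 1 := by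
  rw [Nat.card_eq_fintype_card, Fintype.card_coe, Int.card_Icc]
  omega

/-- The signed partition whose only block with more than one element is contained in
`{-j, …, j}`. -/
noncomputable def zeroBlock (n j : ℕ) : SignedPartition (Finset.Icc (-(n : ℤ)) (n : ℤ)) :=
  ker (fun v => if |v.1| ≤ j then 0 else v) fun v => by
    rw [coe_neg, abs_neg]
    split_ifs
    exacts [neg_zero'.symm, rfl]

theorem zeroBlock_rel {j : ℕ} {a b : Finset.Icc (-(n : ℤ)) (n : ℤ)} :
    (zeroBlock n j).1 a b ↔ a = b ∨ (|a.1| ≤ j ∧ |b.1| ≤ j) := by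
  change (if |a.1| ≤ j then 0 else a) = (if |b.1| ≤ j then 0 else b) ↔ _
  have h0 : |(0 : Finset.Icc (-(n : ℤ)) (n : ℤ)).1| ≤ (j : ℤ) := by simp [coe_zero]
  split_ifs with h1 h2 h2
  · simp [h1, h2]
  · simp only [h2, and_false, or_false]
    exact iff_of_false (fun h => h2 (h ▸ h0)) (fun h => h2 (h ▸ h1))
  · simp only [h1, false_and, or_false]
    exact iff_of_false (fun h => h1 (h ▸ h0)) (fun h => h1 (h ▸ h2))
  · simp [h1]

theorem zeroBlock_mono : Monotone (zeroBlock n) := by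
  intro j k hjk a b h
  have hjk' : (j : ℤ) ≤ k := by exact_mod_cast hjk
  rw [zeroBlock_rel] at h ⊢
  exact h.imp_right fun h => ⟨h.1.trans hjk', h.2.trans hjk'⟩

theorem zeroBlock_injOn : Set.InjOn (zeroBlock n) (Finset.range (n + 1)) := by
  have key : ∀ j k, j < k → k ≤ n → zeroBlock n j ≠ zeroBlock n k := by
    intro j k hjk hk h
    let v : Finset.Icc (-(n : ℤ)) (n : ℤ) := ⟨k, Finset.mem_Icc.2 (by omega)⟩
    have h1 : (zeroBlock n k).1 v 0 := zeroBlock_rel.2 (Or.inr (by simp [v, coe_zero]))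
    rw [← h, zeroBlock_rel] at h1
    rcases h1 with h1 | h1
    · have := congrArg Subtype.val h1
      simp only [v, coe_zero] at this
      omega
    · have := h1.1
      simp only [v, Nat.abs_cast] at this
      omega
  intro j hj k hk h
  simp only [Finset.coe_range, Set.mem_Iio] at hj hk
  rcases lt_trichotomy j k with hlt | heq | hlt
  · exact absurd h (key j k hlt (by omega))
  · exact heq
  · exact absurd h.symm (key k j hlt (by omega))

theorem maxChainCard_eq (n : ℕ) [Fintype (PiB n)] : maxChainCard (PiB n) = n + 1 := by
  classical
  refine le_antisymm (Finset.sup_le fun C hC => ?_) ?_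
  · rw [mem_orderComplex] at hC
    rw [← Finset.card_range (n + 1)]
    refine Finset.card_le_card_of_injOn (fun π => rank (orderIso n π)) (fun π _ => ?_) ?_
    · have h1 := card_quotient (orderIso n π)
      have h2 : Nat.card (Quotient (orderIso n π).1) ≤ _ :=
        Nat.card_le_card_of_surjective _ Quotient.mk_surjective
      rw [card_Icc] at h2
      simp only [Finset.coe_range, Set.mem_Iio]
      omega
    · intro π hπ π' hπ' h
      by_contra hne
      simp only at h
      rcases hC hπ hπ' hne with hle | hle
      · have := rank_lt_of_lt ((orderIso n).lt_iff_lt.2 (hle.lt_of_ne hne))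
        omega
      · have := rank_lt_of_lt ((orderIso n).lt_iff_lt.2 (hle.lt_of_ne (Ne.symm hne)))
        omega
  · have hinj : Set.InjOn (fun j => (orderIso n).symm (zeroBlock n j)) (Finset.range (n + 1)) :=
      (orderIso n).symm.injective.comp_injOn zeroBlock_injOn
    have hchain : (Finset.range (n + 1)).image (fun j => (orderIso n).symm (zeroBlock n j)) ∈
        orderComplex (PiB n) := by
      rw [mem_orderComplex, Finset.coe_image]
      rintro _ ⟨j, _, rfl⟩ _ ⟨k, _, rfl⟩ _
      exact (le_total j k).imp (fun h => (orderIso n).symm.monotone (zeroBlock_mono h))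
        (fun h => (orderIso n).symm.monotone (zeroBlock_mono h))
    have := card_le_maxChainCard hchain
    rwa [Finset.card_image_of_injOn hinj, Finset.card_range] at this

open Polynomial in
theorem hPoly_eq (n : ℕ) [Fintype (PiB n)] : hPoly (PiB n) = hRefined n 0 := by
  refine eq_of_infinite_eval_eq _ _ ((Set.Ioi_infinite (1 : ℝ)).mono fun t ht => ?_)
  have h1 : 1 - t ≠ 0 := by
    have : 1 < t := ht
    linarith
  rw [Set.mem_ofPred_eq, eval_hPoly h1, maxChainCard_eq, chainSum_congr (orderIso n),
    chainSum_eq h1 n _ (card_Icc n)]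
  field_simp
  ring

end PiB

theorem corollary4p5 (n : ℕ) (hn : 1 ≤ n) :
    IsRealRooted (hPoly (PiB n)) ∧ Interlaces (hPoly (PiB n)) (hPoly (PiB (n + 1))) := by
  obtain ⟨m, rfl⟩ : ∃ m, n = m + 1 := ⟨n - 1, by omega⟩
  rw [PiB.hPoly_eq, PiB.hPoly_eq]
  exact ⟨(interlaces_hRefined m).1, interlaces_hRefined m⟩
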